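/- Consider a Chinese auction with given tickets and continuous budgets: there are $n$ players and $m\ge 1$ items; player $i$ has a budget $w_i\ge 0$ and values item $j$ at $v_{i,j}\ge 0$ (budgets and valuations may differ between players and may be zero). A strategy of player $i$ is a vector $x_i=(x_{i,1},\dots,x_{i,m})$ in $$S_i=\Big\{y\in\mathbb{R}^m : y_j\ge 0 \text{ for all } j,\ \sum_{j=1}^m y_j=w_i\Big\},$$ where $x_{i,j}$ is the weight of the tickets that player $i$ places in the basket of item $j$. The auctioneer places a ticket of weight $\Delta_j>0$ in the basket of each item $j$, and nobody gets item $j$ if this ticket is drawn, so that the expected utility of player $i$ is $$u_i(x)=\sum_{j=1}^m \frac{x_{i,j}}{\Delta_j+\sum_{k=1}^n x_{k,j}}\,v_{i,j}.$$ Then every $u_i$ is continuous on $S_1\times\cdots\times S_n$ and concave in player $i$'s own strategy $x_i\in S_i$ for all fixed strategies of the other players, and the game has a pure Nash equilibrium: there is $x\in S_1\times\cdots\times S_n$ with $u_i(y_i,x_{-i})\le u_i(x)$ for every player $i$ and every $y_i\in S_i$. -/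

import Mathlib

open scoped BigOperators

/-- A game in strategic form with players `ι`, whose strategies live in the ambient type `S`:
player `i` chooses an element of `strategies i`, and receives `payoff i x` under the profile `x`. -/
structure StrategicGame (ι : Type*) (S : Type*) where
  strategies : ι → Set S
  payoff : ι → (ι → S) → ℝ

namespace StrategicGame

variable {ι S : Type*}

/-- The set of strategy profiles: every player uses one of their own strategies. -/
def profiles (G : StrategicGame ι S) : Set (ι → S) :=
  {x | ∀ i, x i ∈ G.strategies i}

/-- `x` is a pure Nash equilibrium: it is a strategy profile, and no player `i` gains by a
unilateral deviation to another of their own strategies `y`. -/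
def IsPureNash [DecidableEq ι] (G : StrategicGame ι S) (x : ι → S) : Prop :=
  x ∈ G.profiles ∧
    ∀ i, ∀ y ∈ G.strategies i, G.payoff i (Function.update x i y) ≤ G.payoff i x

end StrategicGame

namespace ChineseAuction

noncomputable section

/-- The distributions of a continuous budget `b` over `m` items: nonnegative weights with
total exactly `b`. -/
def allocations (m : ℕ) (b : ℝ) : Set (Fin m → ℝ) :=
  {y | (∀ j, 0 ≤ y j) ∧ ∑ j, y j = b}

/-- The probability that player `i` wins item `j` when one ticket is drawn from the basket of `j`,
which holds the weight `x k j` of each player `k` and the auctioneer's ticket of weight `Δ j`.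
For an empty basket it is `0` (the item is kept by the auctioneer), by `a / 0 = 0`. -/
def winProb {n m : ℕ} (Δ : Fin m → ℝ) (x : Fin n → Fin m → ℝ) (i : Fin n) (j : Fin m) : ℝ :=
  x i j / (Δ j + ∑ k, x k j)

/-- The expected utility of player `i` with valuations `v i j`. Tickets are given, so there is no
cost term; nobody gets item `j` if the auctioneer's ticket is drawn. -/
def utility {n m : ℕ} (v : Fin n → Fin m → ℝ) (Δ : Fin m → ℝ) (i : Fin n)
    (x : Fin n → Fin m → ℝ) : ℝ :=
  ∑ j, winProb Δ x i j * v i j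

/-- The Chinese auction with given tickets and continuous budgets: `n` players with budgets `w i`
and valuations `v i j` of the `m` items, and auctioneer's tickets `Δ j` in the baskets. -/
def game {n m : ℕ} (v : Fin n → Fin m → ℝ) (w : Fin n → ℝ) (Δ : Fin m → ℝ) :
    StrategicGame (Fin n) (Fin m → ℝ) where
  strategies i := allocations m (w i)
  payoff i x := utility v Δ i x

end

end ChineseAuction

/-!
The continuity and concavity claims are elementary: with the other strategies fixed, the chance of
player `i` to win item `j` is `y ↦ y / (c + y)` with `c > 0`, which lies below its tangents
(`div_add_le_tangent`).

By the same tangent inequality, a profile `x` is an equilibrium as soon as it solves the variational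
inequality `⟪F x, y - x⟫ ≤ 0` for all profiles `y`, where `F` collects the marginal utility of each
player in the player's own weights: it suffices to test `y` that differ from `x` in the strategy of
one player. The profiles form a compact convex set on which `F` is continuous, so a solution is a
fixed point of `x ↦ P (P x + F (P x))`, where `P` is the nearest-point projection onto that set
(`exists_variationalInequality_solution`).

The fixed point comes from a version of Brouwer's theorem, proved by the volume argument of Milnor
and Rogers. A smooth compactly supported map `ψ` without fixed points would give a retraction
`r x = ρ (x - ψ x) / ‖x - ψ x‖` of a ball to its boundary sphere. Put `G x = r x - x`. For small
`t > 0` the map `x ↦ x + t G x` permutes the ball, so `∫ det (1 + t DG)` over the ball is its volume.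
The integrand is polynomial in `t`, hence the same holds at `t = 1`, where the integrand `det Dr`
vanishes because `r` has constant norm (`no_contDiff_retraction`).
-/

/-! ### Nearest-point projection onto a convex set -/

section ConvexProjection

variable {E : Type*} [NormedAddCommGroup E] [InnerProductSpace ℝ E]

/-- The nearest-point map onto a nonempty complete convex set is `1`-Lipschitz, and it is
characterized by an obtuse-angle condition. -/
theorem exists_lipschitz_convex_projection {K : Set E} (hne : K.Nonempty) (hc : IsComplete K)
    (hK : Convex ℝ K) :
    ∃ P : E → E, LipschitzWith 1 P ∧ (∀ x, P x ∈ K) ∧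
      ∀ x, ∀ w ∈ K, inner ℝ (x - P x) (w - P x) ≤ 0 := by
  choose P hPK hP using exists_norm_eq_iInf_of_complete_convex hne hc hK
  have hin : ∀ x, ∀ w ∈ K, inner ℝ (x - P x) (w - P x) ≤ 0 := fun x =>
    (norm_eq_iInf_iff_real_inner_le_zero hK (hPK x)).1 (hP x)
  refine ⟨P, LipschitzWith.of_dist_le_mul fun x y => ?_, hPK, hin⟩
  rw [NNReal.coe_one, one_mul, dist_eq_norm, dist_eq_norm]
  -- Adding the two obtuse-angle inequalities gives `‖P x - P y‖ ^ 2 ≤ ⟪x - y, P x - P y⟫`.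
  have h1 := hin x (P y) (hPK y)
  have h2 := hin y (P x) (hPK x)
  have h3 : inner ℝ (P x - P y) (P x - P y) ≤ inner ℝ (x - y) (P x - P y) := by
    simp only [inner_sub_left, inner_sub_right] at h1 h2 ⊢
    linarith
  rw [real_inner_self_eq_norm_sq] at h3
  have h4 := real_inner_le_norm (x - y) (P x - P y)
  by_contra! h
  have := norm_nonneg (x - y)
  nlinarith

/-- A point that satisfies the obtuse-angle condition for a point `x` of norm at least `ρ` with
respect to the ball of radius `ρ` lies on the sphere. -/
theorem norm_eq_of_inner_closedBall_nonpos {ρ : ℝ} {x p : E} (hx : ρ ≤ ‖x‖)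
    (hp : p ∈ Metric.closedBall (0 : E) ρ)
    (h : ∀ w ∈ Metric.closedBall (0 : E) ρ, inner ℝ (x - p) (w - p) ≤ 0) : ‖p‖ = ρ := by
  rw [mem_closedBall_zero_iff] at hp
  refine le_antisymm hp (not_lt.1 fun hlt => ?_)
  have hne : 0 < ‖x - p‖ := by
    refine norm_pos_iff.2 (sub_ne_zero.2 ?_)
    rintro rfl
    exact absurd hx (not_le.2 hlt)
  have hs : 0 < (ρ - ‖p‖) / ‖x - p‖ := div_pos (sub_pos.2 hlt) hne
  have hw := h (p + ((ρ - ‖p‖) / ‖x - p‖) • (x - p)) (by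
    rw [mem_closedBall_zero_iff]
    refine (norm_add_le _ _).trans ?_
    rw [norm_smul, Real.norm_of_nonneg hs.le, div_mul_cancel₀ _ hne.ne']
    linarith)
  rw [add_sub_cancel_left, inner_smul_right, real_inner_self_eq_norm_sq] at hw
  have := mul_pos hs (pow_pos hne 2)
  linarith

end ConvexProjection

/-! ### No smooth retraction of a ball onto its boundary -/

section Retraction

open MeasureTheory Metric

theorem bijective_add_smul_of_lipschitzWith {E : Type*} [NormedAddCommGroup E] [NormedSpace ℝ E]
    [CompleteSpace E] {g : E → E} {L : NNReal} (hg : LipschitzWith L g) {t : NNReal}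
    (ht : t * L < 1) : Function.Bijective fun x => x + (t : ℝ) • g x := by
  have hcon : ∀ y, ContractingWith (t * L) fun x => y - (t : ℝ) • g x := fun y => by
    refine ⟨ht, LipschitzWith.of_dist_le_mul fun a b => ?_⟩
    rw [dist_sub_left, dist_smul₀, NNReal.norm_eq, NNReal.coe_mul, mul_assoc]
    exact mul_le_mul_of_nonneg_left (hg.dist_le_mul a b) t.2
  refine ⟨fun a b hab => ?_, fun y => ?_⟩
  · refine (hcon (a + (t : ℝ) • g a)).fixedPoint_unique' ?_ ?_
    · simp [Function.IsFixedPt]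
    · simp only at hab
      simp [Function.IsFixedPt, hab]
  · have h := (hcon y).fixedPoint_isFixedPt
    refine ⟨ContractingWith.fixedPoint _ (hcon y), ?_⟩
    simp only [Function.IsFixedPt] at h
    exact (sub_eq_iff_eq_add.1 h).symm

theorem exists_polynomial_det_one_add_smul {E : Type*} [NormedAddCommGroup E] [NormedSpace ℝ E]
    [FiniteDimensional ℝ E] (A : E →L[ℝ] E) :
    ∃ p : Polynomial ℝ, p.natDegree ≤ Module.finrank ℝ E ∧
      ∀ t : ℝ, p.eval t = (ContinuousLinearMap.id ℝ E + t • A).det := by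
  let b := Module.finBasis ℝ E
  let M := LinearMap.toMatrix b b (A : E →ₗ[ℝ] E)
  refine ⟨Matrix.det ((Polynomial.X : Polynomial ℝ) • M.map Polynomial.C +
    (1 : Matrix _ _ ℝ).map Polynomial.C), ?_, fun t => ?_⟩
  · simpa using Polynomial.natDegree_det_X_add_C_le M 1
  · rw [← Polynomial.coe_evalRingHom, RingHom.map_det]
    have : (ContinuousLinearMap.id ℝ E + t • A).det
        = LinearMap.det (LinearMap.id + t • (A : E →ₗ[ℝ] E)) := rfl
    have hM : LinearMap.toMatrix b b (LinearMap.id + t • (A : E →ₗ[ℝ] E)) = 1 + t • M := by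
      rw [map_add, map_smul, LinearMap.toMatrix_id]
    rw [this, ← LinearMap.det_toMatrix b, hM]
    congr 1
    ext i j
    simp [add_comm, mul_comm t, Matrix.one_apply, apply_ite]

/-- If `∫ det (1 + t A)` does not depend on `t` for small positive `t`, then it has the same value
at `t = 1`. -/
theorem integral_det_one_add_eq {E X : Type*} [NormedAddCommGroup E] [NormedSpace ℝ E]
    [FiniteDimensional ℝ E] [MeasurableSpace X] {μ : Measure X} (A : X → E →L[ℝ] E) {δ c : ℝ}
    (hδ : 0 < δ)
    (hint : ∀ t : ℝ, Integrable (fun x => (ContinuousLinearMap.id ℝ E + t • A x).det) μ)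
    (hc : ∀ t : ℝ, 0 < t → t ≤ δ →
      ∫ x, (ContinuousLinearMap.id ℝ E + t • A x).det ∂μ = c) :
    ∫ x, (ContinuousLinearMap.id ℝ E + A x).det ∂μ = c := by
  -- Lagrange interpolation at `d + 1` nodes in `(0, δ]` expresses the value at `1` of every
  -- polynomial of degree at most `d` by one fixed linear combination of values at the nodes.
  let d := Module.finrank ℝ E
  let s := Finset.range (d + 1)
  let v : ℕ → ℝ := fun k => δ / (k + 1)
  have hv : Set.InjOn v s := fun a _ b _ hab => by
    have ha : (a : ℝ) + 1 ≠ 0 := by positivity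
    have hb : (b : ℝ) + 1 ≠ 0 := by positivity
    have h := (div_eq_div_iff ha hb).1 hab
    have := mul_left_cancel₀ hδ.ne' h
    simpa using this.symm
  have hv0 : ∀ k, 0 < v k := fun k => by positivity
  have hvδ : ∀ k, v k ≤ δ := fun k => div_le_self hδ.le (by linarith [k.cast_nonneg (α := ℝ)])
  let a : ℕ → ℝ := fun k => (Lagrange.basis s v k).eval 1
  have key : ∀ x, (ContinuousLinearMap.id ℝ E + A x).det
      = ∑ k ∈ s, (ContinuousLinearMap.id ℝ E + v k • A x).det * a k := fun x => by
    obtain ⟨p, hp, hpe⟩ := exists_polynomial_det_one_add_smul (A x)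
    have hdeg : p.degree < s.card := by
      rw [Finset.card_range]
      exact p.degree_le_natDegree.trans_lt (by exact_mod_cast Nat.lt_succ_of_le hp)
    have h := congrArg (Polynomial.eval 1) (Lagrange.eq_interpolate hv hdeg)
    rw [Lagrange.interpolate_apply, Polynomial.eval_finsetSum, hpe, one_smul] at h
    rw [h]
    exact Finset.sum_congr rfl fun k _ => by simp [hpe, a]
  have hsum : ∑ k ∈ s, a k = 1 := by
    have h := congrArg (Polynomial.eval 1)
      (Lagrange.sum_basis hv (Finset.nonempty_range_iff.2 d.succ_ne_zero))
    simpa [Polynomial.eval_finsetSum] using h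
  simp_rw [key]
  rw [integral_finsetSum _ fun k _ => (hint (v k)).mul_const _]
  simp_rw [integral_mul_const, hc _ (hv0 _) (hvδ _)]
  rw [← Finset.mul_sum, hsum, mul_one]

variable {E : Type*} [NormedAddCommGroup E] [InnerProductSpace ℝ E] [FiniteDimensional ℝ E]

/-- A derivative of a map of constant nonzero norm is singular: its range is orthogonal to the
value. -/
theorem det_fderiv_eq_zero_of_norm_eq {r : E → E} {ρ : ℝ} (hρ : 0 < ρ) {x : E}
    (hd : DifferentiableAt ℝ r x) (hr : ∀ x, ‖r x‖ = ρ) : (fderiv ℝ r x).det = 0 := by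
  have h1 : HasFDerivAt (fun y => inner ℝ (r y) (r y)) _ x :=
    hd.hasFDerivAt.inner ℝ hd.hasFDerivAt
  have h2 : (fun y => inner ℝ (r y) (r y)) = fun _ => ρ ^ 2 := by
    funext y
    rw [real_inner_self_eq_norm_sq, hr]
  rw [h2] at h1
  have h3 := h1.unique (hasFDerivAt_const _ _)
  have h4 : ∀ u, inner ℝ (r x) (fderiv ℝ r x u) = 0 := fun u => by
    have := DFunLike.congr_fun h3 u
    simp [fderivInnerCLM_apply, real_inner_comm] at this
    linarith
  by_contra hdet
  have hdet' : LinearMap.det (fderiv ℝ r x : E →ₗ[ℝ] E) ≠ 0 := hdet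
  obtain ⟨u, hu⟩ := (LinearMap.equivOfDetNeZero _ hdet').surjective (r x)
  have hu' : fderiv ℝ r x u = r x := hu
  have := h4 u
  rw [hu', real_inner_self_eq_norm_sq, hr] at this
  exact (pow_pos hρ 2).ne' this

/-- There is no continuously differentiable map of a ball to its boundary sphere that fixes the
sphere pointwise. -/
theorem no_contDiff_retraction {r : E → E} {ρ : ℝ} (hρ : 0 < ρ) (hC : ContDiff ℝ 1 r)
    (hr : ∀ x, ‖r x‖ = ρ) (hfix : ∀ x, ‖x‖ = ρ → r x = x) : False := by
  let _ : MeasurableSpace E := borel E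
  have _ : BorelSpace E := ⟨rfl⟩
  let G : E → E := fun x => r x - x
  have hGC : ContDiff ℝ 1 G := hC.sub contDiff_id
  have hA : Continuous (fderiv ℝ G) := hGC.continuous_fderiv one_ne_zero
  have hGd : Differentiable ℝ G := hGC.differentiable one_ne_zero
  obtain ⟨L, hL⟩ : ∃ L : NNReal, ∀ x ∈ closedBall (0 : E) ρ, ‖fderiv ℝ G x‖₊ ≤ L := by
    obtain ⟨C, hC⟩ := (isCompact_closedBall (0 : E) ρ).exists_bound_of_continuousOn hA.continuousOn
    exact ⟨C.toNNReal, fun x hx => NNReal.coe_le_coe.1 ((hC x hx).trans (Real.le_coe_toNNReal C))⟩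
  obtain ⟨P, hP1, hPm, hPi⟩ := exists_lipschitz_convex_projection
    (nonempty_closedBall.2 hρ.le) (isClosed_closedBall (x := (0 : E)) (ε := ρ)).isComplete
    (convex_closedBall (0 : E) ρ)
  -- `G` vanishes on the sphere, so `G ∘ P` is the Lipschitz extension of `G` by zero.
  have hgL : LipschitzWith L (G ∘ P) := by
    have h := (convex_closedBall (0 : E) ρ).lipschitzOnWith_of_nnnorm_fderiv_le
      (fun x _ => hGd x) hL
    refine LipschitzWith.of_dist_le_mul fun x y => ?_
    refine (h.dist_le_mul _ (hPm x) _ (hPm y)).trans ?_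
    gcongr
    simpa using hP1.dist_le_mul x y
  have hg0 : ∀ x, ρ ≤ ‖x‖ → G (P x) = 0 := fun x hx => by
    have := norm_eq_of_inner_closedBall_nonpos hx (hPm x) (hPi x)
    simp [G, hfix _ this]
  have hgG : ∀ x ∈ ball (0 : E) ρ, G (P x) = G x := fun x hx => by
    have h := hPi x x (ball_subset_closedBall hx)
    rw [real_inner_self_nonpos, sub_eq_zero] at h
    rw [← h]
  obtain ⟨ε, hε, hdet⟩ : ∃ ε > 0, ∀ B : E →L[ℝ] E, ‖B‖ < ε →
      0 < (ContinuousLinearMap.id ℝ E + B).det := by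
    have hcont : Continuous fun B : E →L[ℝ] E => (ContinuousLinearMap.id ℝ E + B).det :=
      ContinuousLinearMap.continuous_det.comp (continuous_const.add continuous_id)
    have h0 : (0 : ℝ) < (ContinuousLinearMap.id ℝ E + (0 : E →L[ℝ] E)).det := by
      simp [ContinuousLinearMap.det]
    obtain ⟨ε, hε, h⟩ := Metric.eventually_nhds_iff.1
      ((hcont.tendsto 0).eventually (lt_mem_nhds h0))
    exact ⟨ε, hε, fun B hB => h (by simpa using hB)⟩
  let δ : ℝ := min 1 ε / (2 * (L + 1))
  have hδ : 0 < δ := by positivity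
  have hδL : δ * L < min 1 ε := by
    have hm : 0 < min 1 ε := by positivity
    rw [div_mul_eq_mul_div, div_lt_iff₀ (by positivity)]
    nlinarith [L.2, mul_nonneg hm.le L.2]
  have hint : ∀ t : ℝ, IntegrableOn
      (fun x => (ContinuousLinearMap.id ℝ E + t • fderiv ℝ G x).det) (ball 0 ρ) volume := fun t =>
    ((ContinuousLinearMap.continuous_det.comp
      (continuous_const.add (hA.const_smul t))).continuousOn.integrableOn_compact
        (isCompact_closedBall 0 ρ)).mono_set ball_subset_closedBall
  -- For small `t`, the map `x ↦ x + t G x` permutes the ball, so its Jacobian integrates to the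
  -- volume of the ball.
  have hvol : ∀ t : ℝ, 0 < t → t ≤ δ →
      ∫ x in ball 0 ρ, (ContinuousLinearMap.id ℝ E + t • fderiv ℝ G x).det
        = volume.real (ball (0 : E) ρ) := fun t ht htδ => by
    have htL : t * L < min 1 ε := (mul_le_mul_of_nonneg_right htδ L.2).trans_lt hδL
    lift t to NNReal using ht.le
    have hbij := bijective_add_smul_of_lipschitzWith hgL (t := t)
      (by exact_mod_cast htL.trans_le (min_le_left _ _))
    have heq : Set.EqOn (fun x => x + (t : ℝ) • G x) (fun x => x + (t : ℝ) • (G ∘ P) x)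
        (ball 0 ρ) := fun x hx => by simp [hgG x hx]
    have hinj : Set.InjOn (fun x => x + (t : ℝ) • G x) (ball 0 ρ) :=
      hbij.1.injOn.congr heq.symm
    have himg : (fun x => x + (t : ℝ) • G x) '' ball 0 ρ = ball 0 ρ := by
      rw [heq.image_eq]
      have hout : ∀ z, ρ ≤ ‖z‖ → z + (t : ℝ) • (G ∘ P) z = z := fun z hz => by
        simp [hg0 z hz]
      refine Set.Subset.antisymm ?_ fun y hy => ?_
      · rintro _ ⟨x, hx, rfl⟩
        by_contra hz
        rw [mem_ball_zero_iff, not_lt] at hz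
        have := hbij.1 (hout _ hz)
        simp only at hz this
        rw [this] at hz
        exact absurd (mem_ball_zero_iff.1 hx) (not_lt.2 hz)
      · obtain ⟨x, hx⟩ := hbij.2 y
        refine ⟨x, ?_, hx⟩
        by_contra hz
        rw [mem_ball_zero_iff, not_lt] at hz
        have hxy : x = y := (hout x hz).symm.trans hx
        rw [hxy] at hz
        exact absurd (mem_ball_zero_iff.1 hy) (not_lt.2 hz)
    have hcv := integral_image_eq_integral_abs_det_fderiv_smul volume
      (measurableSet_ball (x := (0 : E)) (ε := ρ))
      (fun x _ => ((hasFDerivAt_id x).add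
        ((hGd x).hasFDerivAt.const_smul (t : ℝ))).hasFDerivWithinAt) hinj (fun _ => (1 : ℝ))
    have himg' : (id + (t : ℝ) • G) '' ball 0 ρ = ball 0 ρ := himg
    rw [himg'] at hcv
    simp only [smul_eq_mul, mul_one, integral_const, measureReal_restrict_apply_univ] at hcv
    rw [hcv]
    refine setIntegral_congr_fun measurableSet_ball fun x hx => (abs_of_pos (hdet _ ?_)).symm
    rw [norm_smul, NNReal.norm_eq]
    have hLx : ‖fderiv ℝ G x‖ ≤ L := hL x (ball_subset_closedBall hx)
    exact lt_of_le_of_lt (mul_le_mul_of_nonneg_left hLx t.2) (htL.trans_le (min_le_right 1 ε))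
  have h1 := integral_det_one_add_eq _ hδ hint hvol
  have h0 : ∀ x, (ContinuousLinearMap.id ℝ E + fderiv ℝ G x).det = 0 := fun x => by
    have hd : DifferentiableAt ℝ r x := hC.differentiable one_ne_zero x
    rw [← det_fderiv_eq_zero_of_norm_eq hρ hd hr, fderiv_fun_sub hd differentiableAt_fun_id,
      fderiv_fun_id, add_sub_cancel]
  simp only [h0, integral_zero] at h1
  have hpos : 0 < volume.real (ball (0 : E) ρ) :=
    ENNReal.toReal_pos (measure_ball_pos _ _ hρ).ne' measure_ball_lt_top.ne
  exact hpos.ne h1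

end Retraction

/-! ### Fixed points and variational inequalities -/

section FixedPoint

variable {E : Type*} [NormedAddCommGroup E] [InnerProductSpace ℝ E] [FiniteDimensional ℝ E]

/-- A form of Brouwer's theorem: a bounded continuous self-map of a Euclidean space has a fixed
point. -/
theorem exists_fixedPoint_of_continuous_of_bounded {φ : E → E} {R : ℝ} (hφ : Continuous φ)
    (hR : ∀ x, ‖φ x‖ ≤ R) : ∃ x, φ x = x := by
  wlog hRpos : 0 < R generalizing R
  · exact this (R := max R 1) (fun x => (hR x).trans (le_max_left _ _)) (by positivity)
  by_contra! hne
  -- Cutting `φ` off outside a large ball creates no fixed point, because a fixed point of the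
  -- truncated map lies where the cut-off function is `1`.
  let χ : ContDiffBump (0 : E) := ⟨R, 2 * R, hRpos, by linarith⟩
  have hne' : ∀ x, χ x • φ x ≠ x := fun x hx => by
    have hxR : ‖x‖ ≤ R := by
      rw [← hx, norm_smul, Real.norm_of_nonneg χ.nonneg]
      exact (mul_le_of_le_one_left (norm_nonneg _) χ.le_one).trans (hR x)
    rw [χ.one_of_mem_closedBall (by simpa [χ] using hxR), one_smul] at hx
    exact hne x hx
  have hχφ : Continuous fun x => χ x • φ x := χ.continuous.smul hφ
  -- An error smaller than the displacement at every point keeps the approximation free of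
  -- fixed points.
  obtain ⟨ψ, hψC, hψ, hψs⟩ := hχφ.exists_contDiff_approx 1
    (ε := fun x => ‖χ x • φ x - x‖) (hχφ.sub continuous_id).norm
    (fun x => norm_pos_iff.2 (sub_ne_zero.2 (hne' x)))
  have hψne : ∀ x, x - ψ x ≠ 0 := fun x hx => by
    have h := hψ x
    rw [← sub_eq_zero.1 hx, dist_comm, dist_eq_norm] at h
    exact lt_irrefl _ h
  have hψ0 : ∀ x, ‖x‖ = 2 * R → ψ x = 0 := fun x hx => by
    by_contra h
    have h1 : χ x • φ x ≠ 0 := hψs h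
    exact h1 (by rw [χ.zero_of_le_dist (by simp [χ, hx]), zero_smul])
  have hC : ContDiff ℝ 1 fun x => x - ψ x := contDiff_id.sub hψC
  refine no_contDiff_retraction (r := fun x => (2 * R / ‖x - ψ x‖) • (x - ψ x)) (ρ := 2 * R)
    (by positivity) ?_ (fun x => ?_) fun x hx => ?_
  · exact (contDiff_const.div (hC.norm ℝ hψne) fun x => norm_ne_zero_iff.2 (hψne x)).smul hC
  · rw [norm_smul, Real.norm_of_nonneg (by positivity),
      div_mul_cancel₀ _ (norm_ne_zero_iff.2 (hψne x))]
  · rw [hψ0 x hx, sub_zero, hx, div_self (by positivity), one_smul]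

/-- The Hartman–Stampacchia theorem: a continuous vector field on a nonempty compact convex set
admits a solution of its variational inequality. -/
theorem exists_variationalInequality_solution {K : Set E} (hne : K.Nonempty) (hc : IsCompact K)
    (hK : Convex ℝ K) {F : E → E} (hF : ContinuousOn F K) :
    ∃ x ∈ K, ∀ y ∈ K, inner ℝ (F x) (y - x) ≤ 0 := by
  obtain ⟨P, hP1, hPK, hP⟩ := exists_lipschitz_convex_projection hne hc.isClosed.isComplete hK
  obtain ⟨R, hR⟩ := hc.isBounded.exists_norm_le
  have hcont : Continuous fun x => P (P x + F (P x)) :=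
    hP1.continuous.comp (hP1.continuous.add (hF.comp_continuous hP1.continuous hPK))
  obtain ⟨x, hx⟩ := exists_fixedPoint_of_continuous_of_bounded hcont fun x => hR _ (hPK _)
  have hxK : x ∈ K := hx ▸ hPK _
  have hPx : P x = x := by
    have h := hP x x hxK
    rw [real_inner_self_nonpos, sub_eq_zero] at h
    exact h.symm
  rw [hPx] at hx
  refine ⟨x, hxK, fun y hy => ?_⟩
  have h := hP (x + F x) y hy
  rwa [hx, add_sub_cancel_left] at h

end FixedPoint

namespace ChineseAuction

/-! ### Concavity of the winning probability -/

section Concavity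

theorem div_add_le_tangent {c a b : ℝ} (hc : 0 < c) (ha : 0 ≤ a) (hb : 0 ≤ b) :
    b / (c + b) ≤ a / (c + a) + c / (c + a) ^ 2 * (b - a) := by
  have h : a / (c + a) + c / (c + a) ^ 2 * (b - a) - b / (c + b)
      = c * (b - a) ^ 2 / ((c + a) ^ 2 * (c + b)) := by
    field_simp
    ring
  have : 0 ≤ c * (b - a) ^ 2 / ((c + a) ^ 2 * (c + b)) := by positivity
  linarith

theorem concaveOn_div_add {c : ℝ} (hc : 0 < c) :
    ConcaveOn ℝ (Set.Ici 0) fun y : ℝ => y / (c + y) := by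
  refine ⟨convex_Ici 0, fun a ha b hb p q hp hq hpq => ?_⟩
  -- Both values lie below the tangent at the convex combination `z`.
  have hz : 0 ≤ p * a + q * b := add_nonneg (mul_nonneg hp ha) (mul_nonneg hq hb)
  have h1 := mul_le_mul_of_nonneg_left (div_add_le_tangent hc hz ha) hp
  have h2 := mul_le_mul_of_nonneg_left (div_add_le_tangent hc hz hb) hq
  simp only [smul_eq_mul]
  set z := p * a + q * b with hzdef
  set f := z / (c + z)
  set f' := c / (c + z) ^ 2
  have : p * (f + f' * (a - z)) + q * (f + f' * (b - z)) = f := by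
    have hq' : q = 1 - p := by linarith
    rw [hzdef, hq']
    ring
  linarith

end Concavity

/-! ### Equilibria of the auction -/

section Game

variable {n m : ℕ} {v : Fin n → Fin m → ℝ} {w : Fin n → ℝ} {Δ : Fin m → ℝ}

theorem convex_allocations (m : ℕ) (b : ℝ) : Convex ℝ (allocations m b) := by
  refine fun x hx y hy p q hp hq hpq => ⟨fun j => ?_, ?_⟩
  · exact add_nonneg (mul_nonneg hp (hx.1 j)) (mul_nonneg hq (hy.1 j))
  · simp only [Pi.add_apply, Pi.smul_apply, smul_eq_mul, Finset.sum_add_distrib,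
      ← Finset.mul_sum, hx.2, hy.2]
    rw [← add_mul, hpq, one_mul]

theorem isCompact_allocations (m : ℕ) (b : ℝ) : IsCompact (allocations m b) := by
  refine (isCompact_Icc (a := (0 : Fin m → ℝ)) (b := fun _ => b)).of_isClosed_subset ?_
    fun y hy => ⟨hy.1, fun j => ?_⟩
  · have : allocations m b = (⋂ j, {y | 0 ≤ y j}) ∩ {y | ∑ j, y j = b} := by
      ext
      simp [allocations]
    rw [this]
    exact (isClosed_iInter fun j => isClosed_le continuous_const (continuous_apply j)).inter
      (isClosed_eq (by fun_prop) continuous_const)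
  · rw [← hy.2]
    exact Finset.single_le_sum (fun k _ => hy.1 k) (Finset.mem_univ j)

theorem allocations_nonempty (hm : 0 < m) {b : ℝ} (hb : 0 ≤ b) : (allocations m b).Nonempty :=
  ⟨Pi.single ⟨0, hm⟩ b, fun j => by
    by_cases h : j = ⟨0, hm⟩
    · subst h
      simpa using hb
    · simp [h], by simp⟩

theorem profiles_eq_pi : (game v w Δ).profiles = Set.univ.pi fun i => allocations m (w i) := by
  ext
  simp [StrategicGame.profiles, game]

theorem basket_pos (hΔ : ∀ j, 0 < Δ j) {x : Fin n → Fin m → ℝ}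
    (hx : x ∈ (game v w Δ).profiles) (j : Fin m) : 0 < Δ j + ∑ k, x k j :=
  add_pos_of_pos_of_nonneg (hΔ j) (Finset.sum_nonneg fun k _ => (hx k).1 j)

/-- The weight in the basket of item `j` that does not come from player `i`. -/
noncomputable def otherWeight (Δ : Fin m → ℝ) (x : Fin n → Fin m → ℝ) (i : Fin n) (j : Fin m) : ℝ :=
  Δ j + ∑ k ∈ Finset.univ.erase i, x k j

theorem otherWeight_pos (hΔ : ∀ j, 0 < Δ j) {x : Fin n → Fin m → ℝ}
    (hx : x ∈ (game v w Δ).profiles) (i : Fin n) (j : Fin m) : 0 < otherWeight Δ x i j :=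
  add_pos_of_pos_of_nonneg (hΔ j) (Finset.sum_nonneg fun k _ => (hx k).1 j)

theorem otherWeight_add (x : Fin n → Fin m → ℝ) (i : Fin n) (j : Fin m) :
    otherWeight Δ x i j + x i j = Δ j + ∑ k, x k j := by
  rw [otherWeight, add_assoc, Finset.sum_erase_add _ _ (Finset.mem_univ i)]

theorem utility_eq (x : Fin n → Fin m → ℝ) (i : Fin n) :
    utility v Δ i x = ∑ j, x i j / (otherWeight Δ x i j + x i j) * v i j := by
  simp only [utility, winProb, otherWeight_add]

theorem utility_update (x : Fin n → Fin m → ℝ) (i : Fin n) (y : Fin m → ℝ) :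
    utility v Δ i (Function.update x i y)
      = ∑ j, y j / (otherWeight Δ x i j + y j) * v i j := by
  have h : ∀ j, otherWeight Δ (Function.update x i y) i j = otherWeight Δ x i j := fun j => by
    simp only [otherWeight]
    congr 1
    exact Finset.sum_congr rfl fun k hk => by
      rw [Function.update_of_ne (Finset.ne_of_mem_erase hk)]
  simp only [utility_eq, h, Function.update_self]

theorem continuousOn_utility (hΔ : ∀ j, 0 < Δ j) (i : Fin n) :
    ContinuousOn (utility v Δ i) (game v w Δ).profiles := by
  refine continuousOn_finsetSum _ fun j _ => ContinuousOn.mul ?_ continuousOn_const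
  exact ContinuousOn.div (by fun_prop) (by fun_prop) fun x hx => (basket_pos hΔ hx j).ne'

theorem concaveOn_utility_update (hv : ∀ i j, 0 ≤ v i j) (hΔ : ∀ j, 0 < Δ j) (i : Fin n)
    {x : Fin n → Fin m → ℝ} (hx : x ∈ (game v w Δ).profiles) :
    ConcaveOn ℝ (allocations m (w i)) fun y => utility v Δ i (Function.update x i y) := by
  simp only [utility_update]
  refine ⟨convex_allocations m (w i), fun y hy z hz p q hp hq hpq => ?_⟩
  simp only [smul_eq_mul, Finset.mul_sum, ← Finset.sum_add_distrib]
  refine Finset.sum_le_sum fun j _ => ?_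
  have h := (concaveOn_div_add (otherWeight_pos hΔ hx i j)).2 (hy.1 j) (hz.1 j) hp hq hpq
  have := mul_le_mul_of_nonneg_right h (hv i j)
  simp only [smul_eq_mul, add_mul, mul_assoc] at this
  simpa only [Pi.add_apply, Pi.smul_apply, smul_eq_mul] using this

/-- The partial derivative of the utility of player `i` in the player's own weight `x i j`. -/
noncomputable def marginalUtility (v : Fin n → Fin m → ℝ) (Δ : Fin m → ℝ)
    (x : Fin n → Fin m → ℝ) (i : Fin n) (j : Fin m) : ℝ :=
  otherWeight Δ x i j / (Δ j + ∑ k, x k j) ^ 2 * v i j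

theorem continuousOn_marginalUtility (hΔ : ∀ j, 0 < Δ j) (i : Fin n) (j : Fin m) :
    ContinuousOn (fun x => marginalUtility v Δ x i j) (game v w Δ).profiles := by
  unfold marginalUtility otherWeight
  refine ContinuousOn.mul ?_ continuousOn_const
  exact ContinuousOn.div (by fun_prop) (by fun_prop) fun x hx =>
    pow_ne_zero 2 (basket_pos hΔ hx j).ne'

/-- The utility of a deviation lies below the linearization of the utility at `x` in the player's
own strategy. -/
theorem utility_update_le (hv : ∀ i j, 0 ≤ v i j) (hΔ : ∀ j, 0 < Δ j)
    {x : Fin n → Fin m → ℝ} (hx : x ∈ (game v w Δ).profiles) (i : Fin n) {y : Fin m → ℝ}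
    (hy : y ∈ allocations m (w i)) :
    utility v Δ i (Function.update x i y)
      ≤ utility v Δ i x + ∑ j, marginalUtility v Δ x i j * (y j - x i j) := by
  rw [utility_update, utility_eq, ← Finset.sum_add_distrib]
  refine Finset.sum_le_sum fun j _ => ?_
  have h := mul_le_mul_of_nonneg_right
    (div_add_le_tangent (otherWeight_pos hΔ hx i j) ((hx i).1 j) (hy.1 j)) (hv i j)
  rw [otherWeight_add] at h ⊢
  rw [marginalUtility]
  linarith

/-- Strategy profiles as vectors of a Euclidean space; this equips them with an inner product. -/
noncomputable def toEuclidean (n m : ℕ) :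
    (Fin n → Fin m → ℝ) →ₗ[ℝ] EuclideanSpace ℝ (Fin n × Fin m) where
  toFun x := WithLp.toLp 2 fun p => x p.1 p.2
  map_add' _ _ := rfl
  map_smul' _ _ := rfl

theorem continuous_toEuclidean (n m : ℕ) : Continuous (toEuclidean n m) :=
  (PiLp.continuous_toLp 2 _).comp (by fun_prop)

theorem inner_toEuclidean (x y : Fin n → Fin m → ℝ) :
    inner ℝ (toEuclidean n m x) (toEuclidean n m y) = ∑ i, ∑ j, x i j * y i j := by
  rw [PiLp.inner_apply, Fintype.sum_prod_type]
  exact Finset.sum_congr rfl fun i _ => Finset.sum_congr rfl fun j _ => mul_comm _ _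

theorem exists_isPureNash (hm : 0 < m) (hv : ∀ i j, 0 ≤ v i j) (hw : ∀ i, 0 ≤ w i)
    (hΔ : ∀ j, 0 < Δ j) : ∃ x, (game v w Δ).IsPureNash x := by
  let T := toEuclidean n m
  have hT : Continuous T := continuous_toEuclidean n m
  let F : EuclideanSpace ℝ (Fin n × Fin m) → EuclideanSpace ℝ (Fin n × Fin m) := fun z =>
    T (marginalUtility v Δ fun i j => z (i, j))
  have hcompact : IsCompact (game v w Δ).profiles := by
    rw [profiles_eq_pi]
    exact isCompact_univ_pi fun i => isCompact_allocations m (w i)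
  have hconvex : Convex ℝ (game v w Δ).profiles := by
    rw [profiles_eq_pi]
    exact convex_pi fun i _ => convex_allocations m (w i)
  have hnonempty : (game v w Δ).profiles.Nonempty := by
    rw [profiles_eq_pi]
    exact Set.univ_pi_nonempty_iff.2 fun i => allocations_nonempty hm (hw i)
  have hF : ContinuousOn F (T '' (game v w Δ).profiles) := by
    refine hT.comp_continuousOn (continuousOn_pi.2 fun i => continuousOn_pi.2 fun j => ?_)
    refine (continuousOn_marginalUtility hΔ i j).comp (t := (game v w Δ).profiles)
      (f := fun (z : EuclideanSpace ℝ (Fin n × Fin m)) i j => z (i, j)) (by fun_prop) ?_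
    rintro _ ⟨x, hx, rfl⟩
    exact hx
  obtain ⟨_, ⟨x, hx, rfl⟩, hvi⟩ := exists_variationalInequality_solution
    (hnonempty.image T) (hcompact.image hT) (hconvex.linear_image T) hF
  refine ⟨x, hx, fun i y hy => ?_⟩
  have hupd : Function.update x i y ∈ (game v w Δ).profiles := fun k => by
    rcases eq_or_ne k i with rfl | hk
    · simpa using hy
    · simpa [hk] using hx k
  -- Against a unilateral deviation only the block of player `i` contributes to the inner product.
  have h := hvi _ (Set.mem_image_of_mem T hupd)
  have hsum : inner ℝ (F (T x)) (T (Function.update x i y) - T x)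
      = ∑ j, marginalUtility v Δ x i j * (y j - x i j) := by
    rw [← map_sub]
    refine (inner_toEuclidean (marginalUtility v Δ x) _).trans ?_
    rw [Finset.sum_eq_single i]
    · simp only [Pi.sub_apply, Function.update_self]
    · intro k _ hk
      simp only [Pi.sub_apply, Function.update_of_ne hk, sub_self, mul_zero,
        Finset.sum_const_zero]
    · exact fun hi => absurd (Finset.mem_univ i) hi
  rw [hsum] at h
  have := utility_update_le hv hΔ hx i hy
  change utility v Δ i (Function.update x i y) ≤ utility v Δ i x
  linarith

end Game

end ChineseAuction

theorem mainTheorem3 (n m : ℕ) (hm : 0 < m)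
    (v : Fin n → Fin m → ℝ) (hv : ∀ i j, 0 ≤ v i j)
    (w : Fin n → ℝ) (hw : ∀ i, 0 ≤ w i)
    (Δ : Fin m → ℝ) (hΔ : ∀ j, 0 < Δ j) :
    (∀ i, ContinuousOn ((ChineseAuction.game v w Δ).payoff i)
        (ChineseAuction.game v w Δ).profiles) ∧
    (∀ i, ∀ x ∈ (ChineseAuction.game v w Δ).profiles,
        ConcaveOn ℝ ((ChineseAuction.game v w Δ).strategies i)
          (fun y => (ChineseAuction.game v w Δ).payoff i (Function.update x i y))) ∧
    (∃ x : Fin n → Fin m → ℝ, (ChineseAuction.game v w Δ).IsPureNash x) :=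
  ⟨ChineseAuction.continuousOn_utility hΔ,
    fun i _ hx => ChineseAuction.concaveOn_utility_update hv hΔ i hx,
    ChineseAuction.exists_isPureNash hm hv hw hΔ⟩
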